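/- Consider an interior permanent magnet synchronous motor (IPMSM) with current $i=i_{\alpha\beta}\in\mathbb R^2$, rotor angle $\theta$, speed $\omega$, parameters $n_p,L_d,L_q,R_s,\Phi,J,f$ with $L_d,L_q,J>0$ and $L_d\neq L_q$, load torque $T_L(t)$ and voltage $v$: $$L(\theta)\dot i=F(i,\theta,\omega)+v,\qquad \dot\theta=n_p\omega,\qquad J\dot\omega=n_p\Phi(i_\beta\cos\theta-i_\alpha\sin\theta)-f\omega-T_L ,$$ where $L_0=\tfrac12(L_d+L_q)$, $L_1=\tfrac12(L_d-L_q)$, $Q(\theta)=\begin{bmatrix}\cos2\theta&\sin2\theta\\ \sin2\theta&-\cos2\theta\end{bmatrix}$, $\mathcal J=\begin{bmatrix}0&-1\\1&0\end{bmatrix}$, $L(\theta)=L_0I+L_1Q(\theta)$ and $$F(i,\theta,\omega)=\big(2n_p\omega L_1Q(\theta)\mathcal J-R_sI\big)i+n_p\omega\Phi\begin{bmatrix}\sin\theta\\-\cos\theta\end{bmatrix}.$$ Let $V_h>0$, $\omega_\star>0$, and let the voltage be $v=v^C+(V_h\sin\omega_ht,\,0)^\top$ with $v^C=\Sigma_C[i]$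 the output of a controller $\Sigma_C$. Let $(\bar i,\bar\theta,\bar\omega)$ be a trajectory of the closed loop without injection ($v=\Sigma_C[\bar i]$, same $T_L$). Assume that there are constants $M,\ell_\omega$ independent of $\omega_h$ such that, for all $t>0$, the states satisfy $|i|,|\omega|,|\bar i|,|\bar\omega|\le M$ ($\theta$ is an angle and need not be bounded as a real number), that $v^C$ is differentiable, and that $|(\bar\omega,\dot{\bar\omega},\dot v^C)|\le\ell_\omega$. With $\lambda_h=\omega_h$, $\lambda_\ell=\max\{\sqrt{\omega_h\omega_\star},1\}$, $\mathtt{HPF}(s)=\frac{2s^2}{(\lambda_h+s)^2}$, $\mathtt{LPF}(s)=\frac{\lambda_\ell}{\lambda_\ell+s}$ (arbitrary filter initial conditions), put $$y_h=\mathtt{HPF}[i],\qquad Y=2\frac{\omega_h}{V_h}L_dL_q\,\mathtt{LPF}\big[y_h\sin(\omega_ht)\big],\qquad \hat\theta=\tfrac12\arctan\Big\{\frac{Y_\beta}{Y_\alpha-L_0}\Big\},$$ where $\arctan$ is the two-argument arctangent: $\hat\theta=\tfrac12\operatorname{atan2}(Y_\beta,\,Y_\alpha-L_0)$ if $L_d<L_q$,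 and $\hat\theta=\tfrac12\operatorname{atan2}(-Y_\beta,\,-(Y_\alpha-L_0))$ if $L_d>L_q$. Then there are constants $\omega_h^\star>0$ and $C$, depending only on the motor parameters, $V_h$, $\omega_\star$, $M$ and $\ell_\omega$, such that for every $\omega_h\ge\omega_h^\star$, with $\varepsilon=2\pi/\omega_h$: for all sufficiently large $t$ there is $n\in\mathbb Z$ with $$\big|\hat\theta(t)-\theta(t)-n\pi\big|\le C\varepsilon^{1/2};$$ and if moreover $\theta$ is bounded as a real-valued function, there is $n\in\mathbb Z$ with $$\Big|\limsup_{t\to\infty}|\hat\theta(t)-\theta(t)|-n\pi\Big|\le C\varepsilon^{1/2}.$$ -/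

import Mathlib

noncomputable section

/-- Stationary-frame (`α`-`β`) vectors, with the Euclidean norm; coordinate `0` is `α` and
coordinate `1` is `β`. -/
abbrev Plane : Type := EuclideanSpace ℝ (Fin 2)

/-- Physical parameters of an interior permanent magnet synchronous motor: number of pole pairs
`np`, inductances `Ld`, `Lq`, stator resistance `Rs`, magnet flux `Phi`, drive inertia `J`, friction
constant `f`. -/
structure IPMSM where
  np : ℕ
  Ld : ℝ
  Lq : ℝ
  Rs : ℝ
  Phi : ℝ
  J : ℝ
  f : ℝ

namespace IPMSM

/-- Averaged inductance. -/
def L0 (m : IPMSM) : ℝ := (m.Ld + m.Lq) / 2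

/-- Inductance difference value. -/
def L1 (m : IPMSM) : ℝ := (m.Ld - m.Lq) / 2

end IPMSM

/-- The matrix `𝒥`. -/
def rotJ : Matrix (Fin 2) (Fin 2) ℝ := !![0, -1; 1, 0]

/-- The saliency matrix `Q(θ)`. -/
def matQ (θ : ℝ) : Matrix (Fin 2) (Fin 2) ℝ :=
  !![Real.cos (2 * θ), Real.sin (2 * θ); Real.sin (2 * θ), -Real.cos (2 * θ)]

namespace IPMSM

/-- The inductance matrix `L(θ) = L₀ I + L₁ Q(θ)`. -/
def matL (m : IPMSM) (θ : ℝ) : Matrix (Fin 2) (Fin 2) ℝ :=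
  m.L0 • (1 : Matrix (Fin 2) (Fin 2) ℝ) + m.L1 • matQ θ

/-- `F(i, θ, ω) = (2 n_p ω L₁ Q(θ) 𝒥 - R_s I) i + n_p ω Φ (sin θ, -cos θ)`. -/
def vecF (m : IPMSM) (i : Plane) (θ ω : ℝ) : Plane :=
  Matrix.toEuclideanLin
      ((2 * m.np * ω * m.L1) • (matQ θ * rotJ) - m.Rs • (1 : Matrix (Fin 2) (Fin 2) ℝ)) i
    + (m.np * ω * m.Phi) • !₂[Real.sin θ, -Real.cos θ]

/-- `(i, θ, ω)` solves, at all positive times, the state equations of the motor under the stator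
voltage `v` and the load torque `TL`. -/
structure IsTrajectory (m : IPMSM) (TL : ℝ → ℝ) (v i : ℝ → Plane) (θ ω : ℝ → ℝ) : Prop where
  current : ∀ t > 0, DifferentiableAt ℝ i t ∧
    Matrix.toEuclideanLin (m.matL (θ t)) (deriv i t) = m.vecF (i t) (θ t) (ω t) + v t
  angle : ∀ t > 0, HasDerivAt θ (m.np * ω t) t
  speed : ∀ t > 0, DifferentiableAt ℝ ω t ∧
    m.J * deriv ω t =
      m.np * m.Phi * (i t 1 * Real.cos (θ t) - i t 0 * Real.sin (θ t)) - m.f * ω t - TL t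

end IPMSM

/-- The high-frequency probing voltage, injected in the `α`-axis. -/
def injection (Vh ωh : ℝ) (t : ℝ) : Plane := !₂[Vh * Real.sin (ωh * t), 0]

/-- `y` is an output of the high-pass filter `2 s² / (lam + s)²` driven by `u`, that is,
`(lam + p)² y = 2 p² u` with `p = d/dt`, for arbitrary initial conditions of the filter. -/
def IsHPF (lam : ℝ) (u y : ℝ → Plane) : Prop :=
  ∃ u' u'' y' y'' : ℝ → Plane, ∀ t > 0,
    HasDerivAt u (u' t) t ∧ HasDerivAt u' (u'' t) t ∧
    HasDerivAt y (y' t) t ∧ HasDerivAt y' (y'' t) t ∧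
    y'' t + (2 * lam) • y' t + lam ^ 2 • y t = (2 : ℝ) • u'' t

/-- `y` is an output of the low-pass filter `lam / (lam + s)` driven by `u`, that is,
`(lam + p) y = lam u` with `p = d/dt`, for an arbitrary initial condition of the filter. -/
def IsLPF (lam : ℝ) (u y : ℝ → Plane) : Prop :=
  ∃ y' : ℝ → Plane, ∀ t > 0, HasDerivAt y (y' t) t ∧ y' t + lam • y t = lam • u t

/-- The two-argument arctangent: the angle in `(-π, π]` of the point with abscissa `x` and
ordinate `y`. -/
def atan2 (y x : ℝ) : ℝ := Complex.arg ⟨x, y⟩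

namespace IPMSM

/-- Position estimate computed from `Y`: half of the four-quadrant arctangent of the quotient
`Y_β / (Y_α - L₀)`. The ideal value of `(Y_α - L₀, Y_β)` is `-L₁ (cos 2θ, sin 2θ)`, so that numerator
and denominator are taken as they stand when `L₁ < 0` and are both negated when `L₁ > 0`. -/
def positionEstimate (m : IPMSM) (Y : Plane) : ℝ :=
  if m.Ld < m.Lq then (1 / 2) * atan2 (Y 1) (Y 0 - m.L0)
  else (1 / 2) * atan2 (-(Y 1)) (-(Y 0 - m.L0))

/-- `θhat` is produced from the measured current `i` by high-pass filtering (parameter `lamh`),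
demodulation with `sin (ωh t + φ)`, low-pass filtering (parameter `laml`), scaling by
`2 (ωh / Vh) Ld Lq`, and the arctangent. -/
def IsFilteredEstimate (m : IPMSM) (Vh ωh lamh laml φ : ℝ) (i : ℝ → Plane) (θhat : ℝ → ℝ) : Prop :=
  ∃ yh yl : ℝ → Plane,
    IsHPF lamh i yh ∧
    IsLPF laml (fun t => Real.sin (ωh * t + φ) • yh t) yl ∧
    ∀ t > 0, θhat t = m.positionEstimate ((2 * (ωh / Vh) * m.Ld * m.Lq) • yl t)

end IPMSM

end

/-! ### Asymptotic gain of linear filters -/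

open Filter Topology

/-! Solving the current equation for the derivative gives `i' = s + V sin(ωh t) b`, where `V = Vh /
(Ld Lq)` and `b = Ld Lq L(θ)⁻¹ e₁ = (L₀ - L₁ cos 2θ, -L₁ sin 2θ)` encodes the angle. If `s'`, `b`,
`b'`, `b''` are bounded independently of `ωh`, the high-pass output is `(V/ωh) sin(ωh t) b` up to
`O(ωh⁻²)` (`highPass_ripple`). Demodulation and a low-pass filter of bandwidth `l` then recover `b`
up to `O(1/l + l/ωh)` (`lowPass_demodulation`), and `l ~ √ωh` balances the two errors. The
four-quadrant arctangent is stable under such a perturbation since its radius `|L₁|` is positive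
(`exists_abs_atan2_sub_le`).

The remaining work is uniformity. Bounds are proved over the type `InjectionLoop` of all admissible
trajectories and frequencies, so each constant is fixed before the trajectory. Two bounds are not
assumed: the load torque is bounded through the trajectory without injection, and the control
voltage is bounded because the flux is bounded while the control varies slowly. -/

theorem eventually_norm_le_of_hasDerivAt_add_smul {E : Type*} [NormedAddCommGroup E]
    [NormedSpace ℝ E] {lam K T : ℝ} (hlam : 0 < lam) (hK : 0 < K) {z z' r : ℝ → E}
    (hz : ∀ t ≥ T, HasDerivAt z (z' t) t) (heq : ∀ t ≥ T, z' t + lam • z t = r t)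
    (hr : ∀ t ≥ T, ‖r t‖ ≤ K) :
    ∀ᶠ t in atTop, ‖z t‖ ≤ 2 * K / lam := by
  have hexp : ∀ t, HasDerivAt (fun t => Real.exp (lam * t)) (lam * Real.exp (lam * t)) t := by
    intro t
    have h := ((hasDerivAt_id t).const_mul lam).exp
    simpa [mul_comm] using h
  set c : ℝ := Real.exp (lam * T) * ‖z T‖ with hc
  -- With the integrating factor, `exp(lam t) z` has derivative `exp(lam t) r`, whose norm is at
  -- most the derivative of the right-hand side.
  have hbound : ∀ t ≥ T, Real.exp (lam * t) * ‖z t‖ ≤ K / lam * Real.exp (lam * t) + c := by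
    intro t ht
    have key := image_norm_le_of_norm_deriv_right_le_deriv_boundary'
      (f := fun t => Real.exp (lam * t) • z t) (a := T) (b := t)
      (f' := fun t => Real.exp (lam * t) • r t)
      (B := fun t => K / lam * Real.exp (lam * t) + c)
      (B' := fun t => K * Real.exp (lam * t))
      (fun s hs => ((hexp s).smul (hz s hs.1)).continuousAt.continuousWithinAt)
      (fun s hs => by
        have h := (hexp s).smul (hz s hs.1)
        have h' : Real.exp (lam * s) • z' s + (lam * Real.exp (lam * s)) • z s
            = Real.exp (lam * s) • r s := by
          rw [← heq s hs.1, smul_add, smul_smul, mul_comm lam (Real.exp _)]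
        rw [h'] at h
        exact h.hasDerivWithinAt)
      (by
        rw [norm_smul, Real.norm_eq_abs, Real.abs_exp, ← hc]
        have : 0 ≤ K / lam * Real.exp (lam * T) := by positivity
        linarith)
      (fun s _ => (((hexp s).const_mul (K / lam)).add_const c).continuousAt.continuousWithinAt)
      (fun s _ => by
        have h := ((hexp s).const_mul (K / lam)).add_const c
        have h' : K / lam * (lam * Real.exp (lam * s)) = K * Real.exp (lam * s) := by
          field_simp
        rw [h'] at h
        exact h.hasDerivWithinAt)
      (fun s hs => by
        rw [norm_smul, Real.norm_eq_abs, Real.abs_exp, mul_comm]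
        exact mul_le_mul_of_nonneg_right (hr s hs.1) (Real.exp_pos _).le)
      (Set.right_mem_Icc.2 ht)
    simpa [norm_smul, Real.abs_exp] using key
  have hlim : Tendsto (fun t => K / lam * Real.exp (lam * t)) atTop atTop :=
    (Real.tendsto_exp_atTop.comp (tendsto_id.const_mul_atTop hlam)).const_mul_atTop (by positivity)
  -- The steady gain is `K / lam`; the factor 2 leaves room for the transient `c`, which is
  -- eventually dominated.
  filter_upwards [hlim.eventually_ge_atTop c, eventually_ge_atTop T] with t h1 h2
  have h3 := hbound t h2
  have hpos := Real.exp_pos (lam * t)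
  have h4 : Real.exp (lam * t) * ‖z t‖ ≤ Real.exp (lam * t) * (2 * K / lam) := by
    have : Real.exp (lam * t) * (2 * K / lam) = 2 * (K / lam * Real.exp (lam * t)) := by ring
    linarith
  exact le_of_mul_le_mul_left h4 hpos

theorem hasDerivAt_sin_const_mul (a t : ℝ) :
    HasDerivAt (fun t => Real.sin (a * t)) (a * Real.cos (a * t)) t := by
  have h := ((hasDerivAt_id t).const_mul a).sin
  simpa [mul_comm] using h

theorem hasDerivAt_cos_const_mul (a t : ℝ) :
    HasDerivAt (fun t => Real.cos (a * t)) (-(a * Real.sin (a * t))) t := by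
  have h := ((hasDerivAt_id t).const_mul a).cos
  simpa [mul_comm] using h

theorem abs_mul_le_of_abs_le_one {a b K : ℝ} (ha : |a| ≤ 1) (hb : |b| ≤ K) : |a * b| ≤ K := by
  rw [abs_mul]
  nlinarith [abs_nonneg a, abs_nonneg b]

/-- Response of the high-pass filter `2 s² / (lam + s)²` to a current with a slow part and a ripple
of frequency `lam`. -/
theorem highPass_ripple {lam V K : ℝ} (hlam : 1 ≤ lam) (hV : 0 < V) (hK : 0 < K)
    {u u' u'' y y' y'' s s' b b' b'' : ℝ → ℝ}
    (hu : ∀ t > 0, HasDerivAt u (u' t) t) (hu' : ∀ t > 0, HasDerivAt u' (u'' t) t)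
    (hy : ∀ t > 0, HasDerivAt y (y' t) t) (hy' : ∀ t > 0, HasDerivAt y' (y'' t) t)
    (hfil : ∀ t > 0, y'' t + 2 * lam * y' t + lam ^ 2 * y t = 2 * u'' t)
    (hud : ∀ t > 0, HasDerivAt u (s t + V * Real.sin (lam * t) * b t) t)
    (hs : ∀ t > 0, HasDerivAt s (s' t) t) (hb : ∀ t > 0, HasDerivAt b (b' t) t)
    (hb' : ∀ t > 0, HasDerivAt b' (b'' t) t)
    (hsK : ∀ t > 0, |s' t| ≤ K) (hbK : ∀ t > 0, |b' t| ≤ K) (hbK' : ∀ t > 0, |b'' t| ≤ K) :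
    ∀ᶠ t in atTop, |y t - V / lam * Real.sin (lam * t) * b t| ≤ (8 + 12 * V) * K / lam ^ 2 := by
  have hl0 : 0 < lam := by linarith
  have hu'' : ∀ t > 0, u'' t = s' t + (V * (lam * Real.cos (lam * t)) * b t
      + V * Real.sin (lam * t) * b' t) := by
    intro t ht
    refine (hu' t ht).unique ?_
    refine ((hs t ht).add (((hasDerivAt_sin_const_mul lam t).const_mul V).mul
      (hb t ht))).congr_of_eventuallyEq ?_
    filter_upwards [lt_mem_nhds ht] with τ hτ
    exact (hu τ hτ).unique (hud τ hτ)
  -- At its corner frequency the filter has gain 1 and phase lead `π/2`: it turns the current ripple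
  -- `-(V/lam) cos(lam t) b` into `(V/lam) sin(lam t) b`.
  set e : ℝ → ℝ := fun t => y t - V / lam * Real.sin (lam * t) * b t with he
  set e' : ℝ → ℝ := fun t => y' t - (V * Real.cos (lam * t) * b t
    + V / lam * Real.sin (lam * t) * b' t) with he'
  set e'' : ℝ → ℝ := fun t => y'' t - (-(V * lam * Real.sin (lam * t)) * b t
    + 2 * (V * Real.cos (lam * t) * b' t) + V / lam * Real.sin (lam * t) * b'' t) with he''
  have hde : ∀ t > 0, HasDerivAt e (e' t) t := by
    intro t ht
    have h := (hy t ht).sub (((hasDerivAt_sin_const_mul lam t).const_mul (V / lam)).mul (hb t ht))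
    refine h.congr_deriv ?_
    simp only [he']
    field_simp
  have hde' : ∀ t > 0, HasDerivAt e' (e'' t) t := by
    intro t ht
    have h := (hy' t ht).sub
      ((((hasDerivAt_cos_const_mul lam t).const_mul V).mul (hb t ht)).add
      (((hasDerivAt_sin_const_mul lam t).const_mul (V / lam)).mul (hb' t ht)))
    refine h.congr_deriv ?_
    simp only [he'']
    field_simp
    ring
  -- In `(lam + p)² e` the terms of size `lam` cancel, so the residual is bounded uniformly in
  -- `lam`.
  set r : ℝ → ℝ := fun t => 2 * s' t - 2 * V * (Real.cos (lam * t) * b' t)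
    - V * (1 / lam * (Real.sin (lam * t) * b'' t)) with hr
  have hres : ∀ t > 0, e'' t + 2 * lam * e' t + lam ^ 2 * e t = r t := by
    intro t ht
    have h1 := hfil t ht
    rw [hu'' t ht] at h1
    simp only [he, he', he'', hr]
    have h2 : y'' t = 2 * (s' t + (V * (lam * Real.cos (lam * t)) * b t
      + V * Real.sin (lam * t) * b' t)) - 2 * lam * y' t - lam ^ 2 * y t := by linarith
    rw [h2]
    field_simp
    ring
  have hrK : ∀ t > 0, |r t| ≤ (2 + 3 * V) * K := by
    intro t ht
    have h1 := abs_mul_le_of_abs_le_one (Real.abs_cos_le_one (lam * t)) (hbK t ht)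
    have h2 := abs_mul_le_of_abs_le_one (Real.abs_sin_le_one (lam * t)) (hbK' t ht)
    have h3 : |1 / lam| ≤ 1 := by
      rw [abs_of_pos (by positivity)]
      exact (div_le_one hl0).2 hlam
    have h4 := abs_mul_le_of_abs_le_one h3 h2
    have h5 := hsK t ht
    rw [abs_le] at *
    simp only [hr]
    constructor <;> nlinarith
  -- The double pole splits into two first-order stages, each gaining a factor `2 / lam`; the
  -- intermediate state is `e' + lam e`.
  have hz : ∀ᶠ t in atTop, ‖e' t + lam * e t‖ ≤ 2 * ((2 + 3 * V) * K) / lam := by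
    refine eventually_norm_le_of_hasDerivAt_add_smul (T := 1) (r := r)
      (z' := fun t => e'' t + lam * e' t) hl0 (by positivity) ?_ ?_ ?_
    · intro t ht
      have ht0 : 0 < t := by linarith
      exact (hde' t ht0).add ((hde t ht0).const_mul lam)
    · intro t ht
      rw [← hres t (by linarith), smul_eq_mul]
      ring
    · intro t ht
      exact hrK t (by linarith)
  obtain ⟨T, hT⟩ := eventually_atTop.1 (hz.and (eventually_ge_atTop 1))
  have hfin := eventually_norm_le_of_hasDerivAt_add_smul (T := T) (z := e) (z' := e')
    (r := fun t => e' t + lam * e t) (K := 2 * ((2 + 3 * V) * K) / lam) hl0 (by positivity)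
    (fun t ht => hde t (by linarith [(hT t ht).2])) (fun t _ => rfl) (fun t ht => (hT t ht).1)
  filter_upwards [hfin] with t ht
  refine ht.trans (le_of_eq ?_)
  field_simp
  ring

/-- Synchronous demodulation of a ripple of frequency `lam`, followed by a low-pass filter. -/
theorem lowPass_demodulation {lam l V K : ℝ} (hlam : 1 ≤ lam) (hl : 1 ≤ l) (hV : 0 < V)
    (hK : 0 < K) {y w w' b b' : ℝ → ℝ}
    (hw : ∀ t > 0, HasDerivAt w (w' t) t)
    (hfil : ∀ t > 0, w' t + l * w t = l * (Real.sin (lam * t) * y t))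
    (hy : ∀ᶠ t in atTop, |y t - V / lam * Real.sin (lam * t) * b t| ≤ K / lam ^ 2)
    (hb : ∀ t > 0, HasDerivAt b (b' t) t)
    (hbK : ∀ t > 0, |b t| ≤ K) (hbK' : ∀ t > 0, |b' t| ≤ K) :
    ∀ᶠ t in atTop, |2 * (lam / V) * w t - b t| ≤ (4 / V + 5) * K * (1 / l + l / lam) := by
  have hl0 : 0 < l := by linarith
  have hlam0 : 0 < lam := by linarith
  obtain ⟨T, hT⟩ := eventually_atTop.1 (hy.and (eventually_ge_atTop 1))
  set e : ℝ → ℝ := fun t => y t - V / lam * Real.sin (lam * t) * b t with he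
  -- Since `2 sin² = 1 - cos 2(·)`, demodulation also produces `-l cos(2 lam t) b`, which is not
  -- small. The last term of `z` is a corrector cancelling it, at the cost of terms of order `l² /
  -- lam`.
  set z : ℝ → ℝ := fun t => 2 * (lam / V) * w t - b t
    + l / (2 * lam) * Real.sin (2 * lam * t) * b t with hz
  set z' : ℝ → ℝ := fun t => 2 * (lam / V) * w' t - b' t
    + (l * Real.cos (2 * lam * t) * b t + l / (2 * lam) * Real.sin (2 * lam * t) * b' t) with hz'
  set r : ℝ → ℝ := fun t => l * (2 * (lam / V)) * (Real.sin (lam * t) * e t) - b' t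
    + l / (2 * lam) * (Real.sin (2 * lam * t) * b' t)
    + l ^ 2 / (2 * lam) * (Real.sin (2 * lam * t) * b t) with hr
  set R : ℝ := l * (2 * (lam / V)) * (K / lam ^ 2) + K + l / (2 * lam) * K
    + l ^ 2 / (2 * lam) * K with hR
  have hzb := eventually_norm_le_of_hasDerivAt_add_smul (T := T) (z := z) (z' := z') (r := r)
    (K := R) hl0 (by positivity) (fun t ht => by
      have ht0 : 0 < t := by linarith [(hT t ht).2]
      have h := (((hw t ht0).const_mul (2 * (lam / V))).sub (hb t ht0)).add
        (((hasDerivAt_sin_const_mul (2 * lam) t).const_mul (l / (2 * lam))).mul (hb t ht0))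
      refine h.congr_deriv ?_
      simp only [hz']
      field_simp) (fun t ht => by
      have ht0 : 0 < t := by linarith [(hT t ht).2]
      have h1 := hfil t ht0
      have h2 : w' t = l * (Real.sin (lam * t) * y t) - l * w t := by linarith
      have h3 : Real.cos (2 * lam * t) = 1 - 2 * Real.sin (lam * t) ^ 2 := by
        rw [mul_assoc, Real.cos_two_mul, Real.cos_sq']
        ring
      simp only [hz, hz', hr, he, h2, h3, smul_eq_mul]
      field_simp
      ring) (fun t ht => by
      have ht0 : 0 < t := by linarith [(hT t ht).2]
      have h1 := abs_mul_le_of_abs_le_one (Real.abs_sin_le_one (lam * t)) (hT t ht).1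
      have h2 := abs_mul_le_of_abs_le_one (Real.abs_sin_le_one (2 * lam * t)) (hbK' t ht0)
      have h3 := abs_mul_le_of_abs_le_one (Real.abs_sin_le_one (2 * lam * t)) (hbK t ht0)
      have h4 := hbK' t ht0
      have c1 : 0 ≤ l * (2 * (lam / V)) := by positivity
      have c2 : 0 ≤ l / (2 * lam) := by positivity
      have c3 : 0 ≤ l ^ 2 / (2 * lam) := by positivity
      have m1 := mul_le_mul_of_nonneg_left h1 c1
      have m2 := mul_le_mul_of_nonneg_left h2 c2
      have m3 := mul_le_mul_of_nonneg_left h3 c3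
      rw [← abs_of_nonneg c1, ← abs_mul, abs_of_nonneg c1] at m1
      rw [← abs_of_nonneg c2, ← abs_mul, abs_of_nonneg c2] at m2
      rw [← abs_of_nonneg c3, ← abs_mul, abs_of_nonneg c3] at m3
      rw [Real.norm_eq_abs]
      simp only [hr, hR]
      refine (abs_add_le _ _).trans (add_le_add ?_ m3)
      refine (abs_add_le _ _).trans (add_le_add ?_ m2)
      exact (abs_sub _ _).trans (add_le_add m1 h4))
  filter_upwards [hzb, eventually_ge_atTop T] with t h1 h2
  have ht0 : 0 < t := by linarith [(hT t h2).2]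
  rw [Real.norm_eq_abs] at h1
  have h3 := abs_mul_le_of_abs_le_one (Real.abs_sin_le_one (2 * lam * t)) (hbK t ht0)
  have c2 : 0 ≤ l / (2 * lam) := by positivity
  have m2 := mul_le_mul_of_nonneg_left h3 c2
  rw [← abs_of_nonneg c2, ← abs_mul, abs_of_nonneg c2] at m2
  have h5 : 2 * (lam / V) * w t - b t = z t - l / (2 * lam) * (Real.sin (2 * lam * t) * b t) := by
    simp only [hz]
    ring
  rw [h5]
  refine (abs_sub _ _).trans ((add_le_add h1 m2).trans ?_)
  have h6 : 2 * R / l + l / (2 * lam) * K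
      = (4 / V + 1) * K * (1 / lam) + 2 * K * (1 / l) + 3 / 2 * K * (l / lam) := by
    simp only [hR]
    field_simp
    ring
  rw [h6]
  -- Here `1 ≤ l` absorbs the `1 / lam` contribution of the high-pass error into `l / lam`.
  have h7 : 1 / lam ≤ l / lam := by gcongr
  have h8 : (4 / V + 1) * K * (1 / lam) ≤ (4 / V + 1) * K * (l / lam) := by gcongr
  have h9 : 0 ≤ (4 / V + 3) * K * (1 / l) := by positivity
  have h10 : 0 ≤ K * (l / lam) := by positivity
  nlinarith

/-! ### A derivative estimate, angles and upper limits -/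

/-- A bounded function whose derivative is a slowly varying function up to a bounded error has a
bounded derivative. -/
theorem abs_le_of_hasDerivAt_approx {ψ ψ' u u' : ℝ → ℝ} {A B D : ℝ}
    (hψ : ∀ t > 0, HasDerivAt ψ (ψ' t) t) (hu : ∀ t > 0, HasDerivAt u (u' t) t)
    (hA : ∀ t > 0, |ψ t| ≤ A) (hB : ∀ t > 0, |ψ' t - u t| ≤ B) (hD : ∀ t > 0, |u' t| ≤ D) :
    ∀ t > 0, |u t| ≤ 2 * A + B + D := by
  intro t ht
  have hu1 : ∀ τ ∈ Set.Icc t (t + 1), |u τ - u t| ≤ D := by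
    intro τ hτ
    have h := (convex_Icc t (t + 1)).norm_image_sub_le_of_norm_hasDerivWithin_le (f := u)
      (f' := u') (C := D)
      (fun x hx => (hu x (lt_of_lt_of_le ht hx.1)).hasDerivWithinAt)
      (fun x hx => hD x (lt_of_lt_of_le ht hx.1)) (Set.left_mem_Icc.2 (by linarith)) hτ
    rw [Real.norm_eq_abs, Real.norm_eq_abs] at h
    have h0 : 0 ≤ D := (abs_nonneg _).trans (hD t ht)
    have h1 : |τ - t| ≤ 1 := by rw [abs_le]; constructor <;> linarith [hτ.1, hτ.2]
    nlinarith
  -- The increment of `ψ τ - τ * u t` over a unit interval is `ψ (t + 1) - ψ t - u t`, and its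
  -- derivative is at most `B + D`.
  have h := (convex_Icc t (t + 1)).norm_image_sub_le_of_norm_hasDerivWithin_le
    (f := fun τ => ψ τ - τ * u t) (f' := fun τ => ψ' τ - 1 * u t) (C := B + D)
    (fun x hx => ((hψ x (lt_of_lt_of_le ht hx.1)).sub
      ((hasDerivAt_id x).mul_const (u t))).hasDerivWithinAt)
    (fun x hx => by
      have h1 := hB x (lt_of_lt_of_le ht hx.1)
      have h2 := hu1 x hx
      rw [Real.norm_eq_abs, abs_le]
      rw [abs_le] at h1 h2
      constructor <;> linarith [h1.1, h1.2, h2.1, h2.2])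
    (Set.left_mem_Icc.2 (by linarith)) (Set.right_mem_Icc.2 (by linarith))
  have h1 := hA t ht
  have h2 := hA (t + 1) (by linarith)
  have h3 : |t + 1 - t| = 1 := by norm_num
  rw [Real.norm_eq_abs, Real.norm_eq_abs, h3, abs_le] at h
  rw [abs_le] at *
  constructor <;> linarith [h.1, h.2, h1.1, h1.2, h2.1, h2.2]

/-- Write `x + iy = r (1 + w) exp(iφ)` with `‖w‖ ≤ 2δ/r ≤ 1/2`. The angular error is the imaginary
part of `log (1 + w)`, of norm at most `3/2 ‖w‖`. -/
theorem exists_abs_atan2_sub_le {r φ δ x y : ℝ} (hr : 0 < r) (hx : |x - r * Real.cos φ| ≤ δ)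
    (hy : |y - r * Real.sin φ| ≤ δ) (hδ : 4 * δ ≤ r) :
    ∃ n : ℤ, |atan2 y x - φ - 2 * Real.pi * n| ≤ 3 * δ / r := by
  set e : ℂ := Complex.exp (-φ * Complex.I) with he
  set d : ℂ := ⟨x - r * Real.cos φ, y - r * Real.sin φ⟩ with hd
  set w : ℂ := d * e / r with hw
  have hen : ‖e‖ = 1 := by
    rw [he, ← Complex.ofReal_neg]
    exact Complex.norm_exp_ofReal_mul_I _
  have hdn : ‖d‖ ≤ 2 * δ := (Complex.norm_le_abs_re_add_abs_im d).trans (by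
    simp only [hd]
    linarith)
  have hwn : ‖w‖ ≤ 2 * δ / r := by
    rw [hw, norm_div, norm_mul, hen, mul_one, Complex.norm_real, Real.norm_of_nonneg hr.le]
    gcongr
  have hw2 : ‖w‖ ≤ 1 / 2 := hwn.trans (by rw [div_le_iff₀ hr]; linarith)
  have hz : (⟨x, y⟩ : ℂ) = (r : ℂ) * ((1 + w) * Complex.exp (φ * Complex.I)) := by
    have h1 : e * Complex.exp (φ * Complex.I) = 1 := by
      rw [he, ← Complex.exp_add]
      simp
    have hr' : (r : ℂ) ≠ 0 := by exact_mod_cast hr.ne'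
    have h2 : (r : ℂ) * ((1 + w) * Complex.exp (φ * Complex.I))
        = r * Complex.exp (φ * Complex.I) + d := by
      rw [hw]
      field_simp
      linear_combination d * h1
    rw [h2]
    apply Complex.ext
    · simp [hd, Complex.exp_ofReal_mul_I_re]
    · simp [hd, Complex.exp_ofReal_mul_I_im]
  have hw0 : 1 + w ≠ 0 := by
    intro h
    have : w = -1 := by linear_combination h
    rw [this] at hw2
    norm_num at hw2
  have harg : |Complex.arg (1 + w)| ≤ 3 * δ / r := by
    rw [← Complex.log_im]
    refine (Complex.abs_im_le_norm _).trans
      ((Complex.norm_log_one_add_half_le_self hw2).trans ?_)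
    have : 3 * δ / r = 3 / 2 * (2 * δ / r) := by ring
    rw [this]
    gcongr
  have hang : ((atan2 y x : ℝ) : Real.Angle) = ((Complex.arg (1 + w) + φ : ℝ) : Real.Angle) := by
    rw [atan2, hz, Complex.arg_real_mul _ hr, Complex.arg_mul_coe_angle hw0 (Complex.exp_ne_zero _),
      Complex.arg_exp_mul_I, Real.Angle.coe_toIocMod, Real.Angle.coe_add]
  obtain ⟨n, hn⟩ := Real.Angle.angle_eq_iff_two_pi_dvd_sub.1 hang
  refine ⟨n, ?_⟩
  have : atan2 y x - φ - 2 * Real.pi * n = Complex.arg (1 + w) := by linarith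
  rwa [this]

/-- The integer may change with `t`, so it cannot be carried through the limit. Instead, closeness
to `pℤ` is a closed condition, read as a norm in `AddCircle p`, and the upper limit is a limit of
values of `f`. -/
theorem exists_abs_limsup_sub_int_mul_le {f : ℝ → ℝ} {p δ B : ℝ}
    (hB : ∀ᶠ t in atTop, |f t| ≤ B)
    (hf : ∀ᶠ t in atTop, ∃ n : ℤ, |f t - n * p| ≤ δ) :
    ∃ n : ℤ, |limsup f atTop - n * p| ≤ δ := by
  set S : Set ℝ := {x | ‖(x : AddCircle p)‖ ≤ δ} with hS
  have hclosed : IsClosed S :=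
    isClosed_le (continuous_norm.comp (AddCircle.continuous_mk' p)) continuous_const
  have hfS : ∀ᶠ t in atTop, f t ∈ S := by
    filter_upwards [hf] with t ⟨n, hn⟩
    have h : ((f t : ℝ) : AddCircle p) = ((f t - n * p : ℝ) : AddCircle p) := by
      rw [AddCircle.coe_sub, ← zsmul_eq_mul, AddCircle.coe_zsmul, AddCircle.coe_period]
      simp
    change ‖((f t : ℝ) : AddCircle p)‖ ≤ δ
    rw [h]
    exact QuotientAddGroup.norm_mk_le_norm.trans hn
  have hbdd : IsBoundedUnder (· ≤ ·) atTop f :=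
    ⟨B, eventually_map.2 (hB.mono fun t ht => (abs_le.1 ht).2)⟩
  have hcob : IsCoboundedUnder (· ≤ ·) atTop f :=
    IsBoundedUnder.isCoboundedUnder_le
      ⟨-B, eventually_map.2 (hB.mono fun t ht => (abs_le.1 ht).1)⟩
  have hmem : limsup f atTop ∈ S := by
    rw [← hclosed.closure_eq, Metric.mem_closure_iff]
    intro ε hε
    have h1 : ∃ᶠ t in atTop, limsup f atTop - ε < f t :=
      frequently_lt_of_lt_limsup hcob (by linarith)
    have h2 : ∀ᶠ t in atTop, f t < limsup f atTop + ε :=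
      eventually_lt_of_limsup_lt (by linarith) hbdd
    obtain ⟨t, ht1, ht2, ht3⟩ := (h1.and_eventually (h2.and hfS)).exists
    refine ⟨f t, ht3, ?_⟩
    rw [Real.dist_eq, abs_lt]
    constructor <;> linarith
  have h := AddCircle.norm_eq p (x := limsup f atTop)
  exact ⟨round (p⁻¹ * limsup f atTop), by rw [← h]; exact hmem⟩
-- Bounds uniform over a family
/-- A family of functions of time is bounded at positive times, uniformly in the parameter. -/
def UniformlyBounded {P : Type*} (f : P → ℝ → ℝ) : Prop := ∃ K, ∀ p, ∀ t > 0, |f p t| ≤ K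

namespace UniformlyBounded

variable {P : Type*} {f g : P → ℝ → ℝ}

theorem const (c : ℝ) : UniformlyBounded fun (_ : P) _ => c := ⟨|c|, fun _ _ _ => le_rfl⟩

theorem sin (a : P → ℝ → ℝ) : UniformlyBounded fun p t => Real.sin (a p t) :=
  ⟨1, fun _ _ _ => Real.abs_sin_le_one _⟩

theorem cos (a : P → ℝ → ℝ) : UniformlyBounded fun p t => Real.cos (a p t) :=
  ⟨1, fun _ _ _ => Real.abs_cos_le_one _⟩

theorem add (hf : UniformlyBounded f) (hg : UniformlyBounded g) :
    UniformlyBounded fun p t => f p t + g p t := by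
  obtain ⟨K, hK⟩ := hf
  obtain ⟨N, hN⟩ := hg
  exact ⟨K + N, fun p t ht => (abs_add_le _ _).trans (add_le_add (hK p t ht) (hN p t ht))⟩

theorem neg (hf : UniformlyBounded f) : UniformlyBounded fun p t => -f p t := by
  obtain ⟨K, hK⟩ := hf
  exact ⟨K, fun p t ht => (abs_neg _).trans_le (hK p t ht)⟩

theorem sub (hf : UniformlyBounded f) (hg : UniformlyBounded g) :
    UniformlyBounded fun p t => f p t - g p t := by
  simpa only [sub_eq_add_neg] using hf.add hg.neg

theorem mul (hf : UniformlyBounded f) (hg : UniformlyBounded g) :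
    UniformlyBounded fun p t => f p t * g p t := by
  obtain ⟨K, hK⟩ := hf
  obtain ⟨N, hN⟩ := hg
  refine ⟨K * N, fun p t ht => ?_⟩
  rw [abs_mul]
  exact mul_le_mul (hK p t ht) (hN p t ht) (abs_nonneg _) ((abs_nonneg _).trans (hK p t ht))

theorem congr (hf : UniformlyBounded f) (h : ∀ p, ∀ t > 0, g p t = f p t) :
    UniformlyBounded g := by
  obtain ⟨K, hK⟩ := hf
  exact ⟨K, fun p t ht => by rw [h p t ht]; exact hK p t ht⟩

end UniformlyBounded

/-- At positive times, the family `f` is differentiable with derivative `f'`, and both are bounded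
uniformly in the parameter. -/
structure UniformlyC1 {P : Type*} (f f' : P → ℝ → ℝ) : Prop where
  hasDerivAt : ∀ p, ∀ t > 0, HasDerivAt (f p) (f' p t) t
  bounded : UniformlyBounded f
  bounded_deriv : UniformlyBounded f'

namespace UniformlyC1

variable {P : Type*} {f f' g g' : P → ℝ → ℝ}

theorem const (c : ℝ) : UniformlyC1 (fun (_ : P) _ => c) (fun _ _ => 0) :=
  ⟨fun _ _ _ => hasDerivAt_const _ _, .const c, .const 0⟩

theorem add (hf : UniformlyC1 f f') (hg : UniformlyC1 g g') :
    UniformlyC1 (fun p t => f p t + g p t) (fun p t => f' p t + g' p t) :=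
  ⟨fun p t ht => (hf.hasDerivAt p t ht).add (hg.hasDerivAt p t ht), hf.bounded.add hg.bounded,
    hf.bounded_deriv.add hg.bounded_deriv⟩

theorem sub (hf : UniformlyC1 f f') (hg : UniformlyC1 g g') :
    UniformlyC1 (fun p t => f p t - g p t) (fun p t => f' p t - g' p t) :=
  ⟨fun p t ht => (hf.hasDerivAt p t ht).sub (hg.hasDerivAt p t ht), hf.bounded.sub hg.bounded,
    hf.bounded_deriv.sub hg.bounded_deriv⟩

theorem mul (hf : UniformlyC1 f f') (hg : UniformlyC1 g g') :
    UniformlyC1 (fun p t => f p t * g p t) (fun p t => f' p t * g p t + f p t * g' p t) :=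
  ⟨fun p t ht => (hf.hasDerivAt p t ht).mul (hg.hasDerivAt p t ht), hf.bounded.mul hg.bounded,
    (hf.bounded_deriv.mul hg.bounded).add (hf.bounded.mul hg.bounded_deriv)⟩

theorem neg (hf : UniformlyC1 f f') : UniformlyC1 (fun p t => -f p t) (fun p t => -f' p t) :=
  ⟨fun p t ht => (hf.hasDerivAt p t ht).neg, hf.bounded.neg, hf.bounded_deriv.neg⟩

theorem const_mul (c : ℝ) (hf : UniformlyC1 f f') :
    UniformlyC1 (fun p t => c * f p t) (fun p t => c * f' p t) :=
  ⟨fun p t ht => (hf.hasDerivAt p t ht).const_mul c, (UniformlyBounded.const c).mul hf.bounded,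
    (UniformlyBounded.const c).mul hf.bounded_deriv⟩

theorem sin (h : ∀ p, ∀ t > 0, HasDerivAt (f p) (f' p t) t) (hb : UniformlyBounded f') :
    UniformlyC1 (fun p t => Real.sin (f p t)) (fun p t => Real.cos (f p t) * f' p t) :=
  ⟨fun p t ht => (h p t ht).sin, .sin f, (UniformlyBounded.cos f).mul hb⟩

theorem cos (h : ∀ p, ∀ t > 0, HasDerivAt (f p) (f' p t) t) (hb : UniformlyBounded f') :
    UniformlyC1 (fun p t => Real.cos (f p t)) (fun p t => -Real.sin (f p t) * f' p t) :=
  ⟨fun p t ht => (h p t ht).cos, .cos f, (UniformlyBounded.sin f).neg.mul hb⟩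

end UniformlyC1

theorem HasDerivAt.plane_apply {u : ℝ → Plane} {u' : Plane} {t : ℝ} (h : HasDerivAt u u' t)
    (k : Fin 2) : HasDerivAt (fun τ => u τ k) (u' k) t :=
  (EuclideanSpace.proj (𝕜 := ℝ) k).hasFDerivAt.comp_hasDerivAt t h

/-! ### Uniform bounds for the motor under injection -/

/-- A motor trajectory under signal injection with bounded states and slowly varying control, with a
trajectory without injection under the same load. -/
structure InjectionLoop (m : IPMSM) (Vh M ℓ : ℝ) where
  ωh : ℝ
  vC : ℝ → Plane
  vbar : ℝ → Plane
  TL : ℝ → ℝ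
  i : ℝ → Plane
  θ : ℝ → ℝ
  ω : ℝ → ℝ
  ibar : ℝ → Plane
  θbar : ℝ → ℝ
  ωbar : ℝ → ℝ
  traj : m.IsTrajectory TL (fun t => vC t + injection Vh ωh t) i θ ω
  traj_bar : m.IsTrajectory TL vbar ibar θbar ωbar
  bound : ∀ t > 0, ‖i t‖ ≤ M ∧ |ω t| ≤ M
  bound_bar : ∀ t > 0, ‖ibar t‖ ≤ M ∧ |ωbar t| ≤ M
  control_differentiable : ∀ t > 0, DifferentiableAt ℝ vC t
  slow : ∀ t > 0, √(ωbar t ^ 2 + deriv ωbar t ^ 2 + ‖deriv vC t‖ ^ 2) ≤ ℓ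

namespace InjectionLoop

variable {m : IPMSM} {Vh M ℓ : ℝ}

theorem bounded_i (k : Fin 2) : UniformlyBounded fun (p : InjectionLoop m Vh M ℓ) t => p.i t k :=
  ⟨M, fun p t ht => (PiLp.norm_apply_le (p.i t) k).trans (p.bound t ht).1⟩

theorem bounded_ibar (k : Fin 2) :
    UniformlyBounded fun (p : InjectionLoop m Vh M ℓ) t => p.ibar t k :=
  ⟨M, fun p t ht => (PiLp.norm_apply_le (p.ibar t) k).trans (p.bound_bar t ht).1⟩

theorem bounded_ω : UniformlyBounded fun (p : InjectionLoop m Vh M ℓ) => p.ω :=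
  ⟨M, fun p t ht => (p.bound t ht).2⟩

theorem bounded_ωbar : UniformlyBounded fun (p : InjectionLoop m Vh M ℓ) => p.ωbar :=
  ⟨M, fun p t ht => (p.bound_bar t ht).2⟩

theorem bounded_deriv_ωbar :
    UniformlyBounded fun (p : InjectionLoop m Vh M ℓ) t => deriv p.ωbar t :=
  ⟨ℓ, fun p t ht => (Real.abs_le_sqrt (by
    linarith [sq_nonneg (p.ωbar t), sq_nonneg ‖deriv p.vC t‖])).trans (p.slow t ht)⟩

theorem bounded_deriv_vC (k : Fin 2) :
    UniformlyBounded fun (p : InjectionLoop m Vh M ℓ) t => deriv p.vC t k :=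
  ⟨ℓ, fun p t ht => (PiLp.norm_apply_le (deriv p.vC t) k).trans
    ((Real.le_sqrt_of_sq_le (by
      linarith [sq_nonneg (p.ωbar t), sq_nonneg (deriv p.ωbar t)])).trans (p.slow t ht))⟩

/-- The torque is read off the speed equation of the trajectory without injection, whose
acceleration is bounded by assumption. It then bounds the acceleration of the injected motor. -/
theorem bounded_TL : UniformlyBounded fun (p : InjectionLoop m Vh M ℓ) => p.TL := by
  refine (((UniformlyBounded.const (m.np * m.Phi)).mul
    (((bounded_ibar 1).mul (.cos fun p t => p.θbar t)).sub
      ((bounded_ibar 0).mul (.sin fun p t => p.θbar t)))).sub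
    (((UniformlyBounded.const m.f).mul bounded_ωbar).add
      ((UniformlyBounded.const m.J).mul bounded_deriv_ωbar))).congr fun p t ht => ?_
  have h := (p.traj_bar.speed t ht).2
  linarith

theorem bounded_deriv_ω (hJ : 0 < m.J) :
    UniformlyBounded fun (p : InjectionLoop m Vh M ℓ) t => deriv p.ω t := by
  refine ((UniformlyBounded.const m.J⁻¹).mul ((((UniformlyBounded.const (m.np * m.Phi)).mul
    (((bounded_i 1).mul (.cos fun p t => p.θ t)).sub
      ((bounded_i 0).mul (.sin fun p t => p.θ t)))).sub
    ((UniformlyBounded.const m.f).mul bounded_ω)).sub bounded_TL)).congr fun p t ht => ?_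
  rw [← (p.traj.speed t ht).2, inv_mul_cancel_left₀ hJ.ne']

theorem uniformlyC1_ω (hJ : 0 < m.J) :
    UniformlyC1 (fun p : InjectionLoop m Vh M ℓ => p.ω) (fun p t => deriv p.ω t) :=
  ⟨fun p t ht => (p.traj.speed t ht).1.hasDerivAt, bounded_ω, bounded_deriv_ω hJ⟩

theorem uniformlyC1_sin : UniformlyC1 (fun (p : InjectionLoop m Vh M ℓ) t => Real.sin (p.θ t))
    (fun p t => Real.cos (p.θ t) * (m.np * p.ω t)) :=
  .sin (fun p t ht => p.traj.angle t ht) ((UniformlyBounded.const _).mul bounded_ω)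

theorem uniformlyC1_cos : UniformlyC1 (fun (p : InjectionLoop m Vh M ℓ) t => Real.cos (p.θ t))
    (fun p t => -Real.sin (p.θ t) * (m.np * p.ω t)) :=
  .cos (fun p t ht => p.traj.angle t ht) ((UniformlyBounded.const _).mul bounded_ω)

theorem uniformlyC1_sin_two :
    UniformlyC1 (fun (p : InjectionLoop m Vh M ℓ) t => Real.sin (2 * p.θ t))
      (fun p t => Real.cos (2 * p.θ t) * (2 * (m.np * p.ω t))) :=
  .sin (fun p t ht => (p.traj.angle t ht).const_mul 2)
    ((UniformlyBounded.const _).mul ((UniformlyBounded.const _).mul bounded_ω))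

theorem uniformlyC1_cos_two :
    UniformlyC1 (fun (p : InjectionLoop m Vh M ℓ) t => Real.cos (2 * p.θ t))
      (fun p t => -Real.sin (2 * p.θ t) * (2 * (m.np * p.ω t))) :=
  .cos (fun p t ht => (p.traj.angle t ht).const_mul 2)
    ((UniformlyBounded.const _).mul ((UniformlyBounded.const _).mul bounded_ω))

/-- The right-hand side of the current equation, without the injected voltage. -/
noncomputable def slowForce (p : InjectionLoop m Vh M ℓ) (t : ℝ) : Fin 2 → ℝ :=
  ![2 * (m.np * m.L1) * (p.ω t * (Real.sin (2 * p.θ t) * p.i t 0 - Real.cos (2 * p.θ t) * p.i t 1))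
      - m.Rs * p.i t 0 + m.np * m.Phi * (p.ω t * Real.sin (p.θ t)) + p.vC t 0,
    -(2 * (m.np * m.L1)) * (p.ω t *
        (Real.cos (2 * p.θ t) * p.i t 0 + Real.sin (2 * p.θ t) * p.i t 1))
      - m.Rs * p.i t 1 - m.np * m.Phi * (p.ω t * Real.cos (p.θ t)) + p.vC t 1]

theorem current_zero (p : InjectionLoop m Vh M ℓ) {t : ℝ} (ht : 0 < t) :
    (m.L0 + m.L1 * Real.cos (2 * p.θ t)) * deriv p.i t 0
      + m.L1 * Real.sin (2 * p.θ t) * deriv p.i t 1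
      = p.slowForce t 0 + Vh * Real.sin (p.ωh * t) := by
  have h := congrArg (fun x : Plane => x 0) (p.traj.current t ht).2
  simp [IPMSM.matL, IPMSM.vecF, matQ, rotJ, injection, Matrix.toLpLin_apply, dotProduct,
    Fin.sum_univ_two] at h
  simp only [slowForce, Matrix.cons_val_zero]
  linear_combination h

theorem current_one (p : InjectionLoop m Vh M ℓ) {t : ℝ} (ht : 0 < t) :
    m.L1 * Real.sin (2 * p.θ t) * deriv p.i t 0
      + (m.L0 - m.L1 * Real.cos (2 * p.θ t)) * deriv p.i t 1 = p.slowForce t 1 := by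
  have h := congrArg (fun x : Plane => x 1) (p.traj.current t ht).2
  simp [IPMSM.matL, IPMSM.vecF, matQ, rotJ, injection, Matrix.toLpLin_apply, dotProduct,
    Fin.sum_univ_two] at h
  simp only [slowForce, Matrix.cons_val_one, Matrix.cons_val_fin_one]
  linear_combination h

theorem hasDerivAt_i (p : InjectionLoop m Vh M ℓ) {t : ℝ} (ht : 0 < t) (k : Fin 2) :
    HasDerivAt (fun τ => p.i τ k) (deriv p.i t k) t :=
  (p.traj.current t ht).1.hasDerivAt.plane_apply k

theorem hasDerivAt_vC (p : InjectionLoop m Vh M ℓ) {t : ℝ} (ht : 0 < t) (k : Fin 2) :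
    HasDerivAt (fun τ => p.vC τ k) (deriv p.vC t k) t :=
  (p.control_differentiable t ht).hasDerivAt.plane_apply k

/-- Meant for `ψ` a component of the flux `L(θ) i`: it is bounded, and its derivative is the voltage
up to bounded terms. -/
theorem bounded_of_flux {k : Fin 2} {ψ ψ' : InjectionLoop m Vh M ℓ → ℝ → ℝ}
    (hψ : ∀ p, ∀ t > 0, HasDerivAt (ψ p) (ψ' p t) t) (hb : UniformlyBounded ψ)
    (hb' : UniformlyBounded fun p t => ψ' p t - p.vC t k) :
    UniformlyBounded fun (p : InjectionLoop m Vh M ℓ) t => p.vC t k := by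
  obtain ⟨A, hA⟩ := hb
  obtain ⟨B, hB⟩ := hb'
  obtain ⟨D, hD⟩ := bounded_deriv_vC (m := m) (Vh := Vh) (M := M) (ℓ := ℓ) k
  exact ⟨2 * A + B + D, fun p => abs_le_of_hasDerivAt_approx (hψ p)
    (fun t ht => p.hasDerivAt_vC ht k) (hA p) (hB p) (hD p)⟩

theorem bounded_vC (k : Fin 2) :
    UniformlyBounded fun (p : InjectionLoop m Vh M ℓ) t => p.vC t k := by
  fin_cases k
  · refine bounded_of_flux (k := 0)
      (ψ := fun p t => (m.L0 + m.L1 * Real.cos (2 * p.θ t)) * p.i t 0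
        + m.L1 * Real.sin (2 * p.θ t) * p.i t 1)
      (fun p t ht => ((((uniformlyC1_cos_two.hasDerivAt p t ht).const_mul m.L1).const_add
        m.L0).mul (p.hasDerivAt_i ht 0)).add
        (((uniformlyC1_sin_two.hasDerivAt p t ht).const_mul m.L1).mul (p.hasDerivAt_i ht 1)))
      ((((UniformlyBounded.const _).add ((UniformlyBounded.const _).mul (.cos _))).mul
        (bounded_i 0)).add (((UniformlyBounded.const _).mul (.sin _)).mul (bounded_i 1))) ?_
    -- The derivative of `L(θ)` applied to `i` cancels the term in `Q(θ) 𝒥` of `F`, leaving the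
    -- resistive drop, the magnet term and the injection.
    refine ((((UniformlyBounded.const m.Rs).mul (bounded_i 0)).neg.add
      ((UniformlyBounded.const (m.np * m.Phi)).mul (bounded_ω.mul (.sin fun p t => p.θ t)))).add
      ((UniformlyBounded.const Vh).mul (.sin fun p t => p.ωh * t))).congr fun p t ht => ?_
    have h := p.current_zero ht
    simp only [slowForce, Matrix.cons_val_zero] at h
    linear_combination h
  · refine bounded_of_flux (k := 1)
      (ψ := fun p t => m.L1 * Real.sin (2 * p.θ t) * p.i t 0
        + (m.L0 - m.L1 * Real.cos (2 * p.θ t)) * p.i t 1)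
      (fun p t ht => (((uniformlyC1_sin_two.hasDerivAt p t ht).const_mul m.L1).mul
        (p.hasDerivAt_i ht 0)).add
        ((((uniformlyC1_cos_two.hasDerivAt p t ht).const_mul m.L1).const_sub
        m.L0).mul (p.hasDerivAt_i ht 1)))
      ((((UniformlyBounded.const _).mul (.sin _)).mul (bounded_i 0)).add
        (((UniformlyBounded.const _).sub ((UniformlyBounded.const _).mul (.cos _))).mul
        (bounded_i 1))) ?_
    refine (((UniformlyBounded.const m.Rs).mul (bounded_i 1)).neg.sub
      ((UniformlyBounded.const (m.np * m.Phi)).mul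
        (bounded_ω.mul (.cos fun p t => p.θ t)))).congr fun p t ht => ?_
    have h := p.current_one ht
    simp only [slowForce, Matrix.cons_val_one, Matrix.cons_val_fin_one] at h
    linear_combination h

/-- The vector `Ld Lq L(θ)⁻¹ e₁`, which carries the position information of the ripple. -/
noncomputable def saliency (p : InjectionLoop m Vh M ℓ) (t : ℝ) : Fin 2 → ℝ :=
  ![m.L0 - m.L1 * Real.cos (2 * p.θ t), -m.L1 * Real.sin (2 * p.θ t)]

/-- The part of the current derivative which is not due to the injected voltage. -/
noncomputable def slowRate (p : InjectionLoop m Vh M ℓ) (t : ℝ) : Fin 2 → ℝ :=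
  ![(m.Ld * m.Lq)⁻¹ * ((m.L0 - m.L1 * Real.cos (2 * p.θ t)) * p.slowForce t 0
      - m.L1 * Real.sin (2 * p.θ t) * p.slowForce t 1),
    (m.Ld * m.Lq)⁻¹ * ((m.L0 + m.L1 * Real.cos (2 * p.θ t)) * p.slowForce t 1
      - m.L1 * Real.sin (2 * p.θ t) * p.slowForce t 0)]

theorem deriv_i_eq (p : InjectionLoop m Vh M ℓ) (hLd : 0 < m.Ld) (hLq : 0 < m.Lq) {t : ℝ}
    (ht : 0 < t) (k : Fin 2) :
    deriv p.i t k
      = p.slowRate t k + Vh / (m.Ld * m.Lq) * Real.sin (p.ωh * t) * p.saliency t k := by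
  have h0 := p.current_zero ht
  have h1 := p.current_one ht
  have hD : m.Ld * m.Lq ≠ 0 := (mul_pos hLd hLq).ne'
  -- The determinant of `L(θ)` is `L₀² - L₁² = Ld Lq`; what follows is Cramer's rule.
  have hdet : (m.L0 + m.L1 * Real.cos (2 * p.θ t)) * (m.L0 - m.L1 * Real.cos (2 * p.θ t))
      - (m.L1 * Real.sin (2 * p.θ t)) ^ 2 = m.Ld * m.Lq := by
    simp only [IPMSM.L0, IPMSM.L1]
    linear_combination (-((m.Ld - m.Lq) / 2) ^ 2) * Real.sin_sq_add_cos_sq (2 * p.θ t)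
  refine mul_left_cancel₀ hD ?_
  fin_cases k
  · simp only [slowRate, saliency, Fin.zero_eta, Matrix.cons_val_zero]
    field_simp
    linear_combination (m.L0 - m.L1 * Real.cos (2 * p.θ t)) * h0
      - m.L1 * Real.sin (2 * p.θ t) * h1 - deriv p.i t 0 * hdet
  · simp only [slowRate, saliency, Fin.mk_one, Matrix.cons_val_one, Matrix.cons_val_fin_one]
    field_simp
    linear_combination (m.L0 + m.L1 * Real.cos (2 * p.θ t)) * h1
      - m.L1 * Real.sin (2 * p.θ t) * h0 - deriv p.i t 1 * hdet

theorem bounded_slowForce (k : Fin 2) :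
    UniformlyBounded fun (p : InjectionLoop m Vh M ℓ) t => p.slowForce t k := by
  fin_cases k
  · exact ((((UniformlyBounded.const _).mul (bounded_ω.mul (((UniformlyBounded.sin _).mul
      (bounded_i 0)).sub ((UniformlyBounded.cos _).mul (bounded_i 1))))).sub
      ((UniformlyBounded.const _).mul (bounded_i 0))).add
      ((UniformlyBounded.const _).mul (bounded_ω.mul (.sin _)))).add (bounded_vC 0)
  · exact ((((UniformlyBounded.const _).mul (bounded_ω.mul (((UniformlyBounded.cos _).mul
      (bounded_i 0)).add ((UniformlyBounded.sin _).mul (bounded_i 1))))).sub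
      ((UniformlyBounded.const _).mul (bounded_i 1))).sub
      ((UniformlyBounded.const _).mul (bounded_ω.mul (.cos _)))).add (bounded_vC 1)

theorem bounded_slowRate (k : Fin 2) :
    UniformlyBounded fun (p : InjectionLoop m Vh M ℓ) t => p.slowRate t k := by
  fin_cases k
  · exact (UniformlyBounded.const _).mul ((((UniformlyBounded.const _).sub
      ((UniformlyBounded.const _).mul (.cos _))).mul (bounded_slowForce 0)).sub
      (((UniformlyBounded.const _).mul (.sin _)).mul (bounded_slowForce 1)))
  · exact (UniformlyBounded.const _).mul ((((UniformlyBounded.const _).add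
      ((UniformlyBounded.const _).mul (.cos _))).mul (bounded_slowForce 1)).sub
      (((UniformlyBounded.const _).mul (.sin _)).mul (bounded_slowForce 0)))

/-- The second derivative involves the acceleration, hence the bound on the load torque. -/
theorem exists_uniformlyC1_saliency (hJ : 0 < m.J) (k : Fin 2) :
    ∃ b' b'', UniformlyC1 (fun (p : InjectionLoop m Vh M ℓ) t => p.saliency t k) b' ∧
      UniformlyC1 b' b'' := by
  fin_cases k
  · exact ⟨_, _, (UniformlyC1.const _).sub (uniformlyC1_cos_two.const_mul _),
      (UniformlyC1.const 0).sub (((uniformlyC1_sin_two.neg.mul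
        (((uniformlyC1_ω hJ).const_mul _).const_mul 2)).const_mul _))⟩
  · exact ⟨_, _, uniformlyC1_sin_two.const_mul _, (uniformlyC1_cos_two.mul
      (((uniformlyC1_ω hJ).const_mul _).const_mul 2)).const_mul _⟩

/-- The injected voltage has fixed amplitude, so it contributes a bounded amount to `i'`. One
derivative of `i` is enough: `slowRate` contains `i` but not `i'`. -/
theorem uniformlyC1_i (hLd : 0 < m.Ld) (hLq : 0 < m.Lq) (hJ : 0 < m.J) (k : Fin 2) :
    UniformlyC1 (fun (p : InjectionLoop m Vh M ℓ) t => p.i t k) (fun p t => deriv p.i t k) := by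
  obtain ⟨b', b'', hb, -⟩ := exists_uniformlyC1_saliency (m := m) (Vh := Vh) (M := M) (ℓ := ℓ) hJ k
  exact ⟨fun p t ht => p.hasDerivAt_i ht k, bounded_i k,
    ((bounded_slowRate k).add (((UniformlyBounded.const _).mul (.sin _)).mul hb.bounded)).congr
      fun p _ ht => p.deriv_i_eq hLd hLq ht k⟩

theorem uniformlyC1_vC (k : Fin 2) :
    UniformlyC1 (fun (p : InjectionLoop m Vh M ℓ) t => p.vC t k) (fun p t => deriv p.vC t k) :=
  ⟨fun p _ ht => p.hasDerivAt_vC ht k, bounded_vC k, bounded_deriv_vC k⟩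

theorem exists_uniformlyC1_slowForce (hLd : 0 < m.Ld) (hLq : 0 < m.Lq) (hJ : 0 < m.J)
    (k : Fin 2) :
    ∃ s', UniformlyC1 (fun (p : InjectionLoop m Vh M ℓ) t => p.slowForce t k) s' := by
  have hω := uniformlyC1_ω (Vh := Vh) (M := M) (ℓ := ℓ) hJ
  have hi := uniformlyC1_i (Vh := Vh) (M := M) (ℓ := ℓ) hLd hLq hJ
  fin_cases k
  · exact ⟨_, ((((hω.mul ((uniformlyC1_sin_two.mul (hi 0)).sub
      (uniformlyC1_cos_two.mul (hi 1)))).const_mul _).sub ((hi 0).const_mul _)).add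
      ((hω.mul uniformlyC1_sin).const_mul _)).add (uniformlyC1_vC 0)⟩
  · exact ⟨_, ((((hω.mul ((uniformlyC1_cos_two.mul (hi 0)).add
      (uniformlyC1_sin_two.mul (hi 1)))).const_mul _).sub ((hi 1).const_mul _)).sub
      ((hω.mul uniformlyC1_cos).const_mul _)).add (uniformlyC1_vC 1)⟩

theorem exists_uniformlyC1_slowRate (hLd : 0 < m.Ld) (hLq : 0 < m.Lq) (hJ : 0 < m.J)
    (k : Fin 2) :
    ∃ s', UniformlyC1 (fun (p : InjectionLoop m Vh M ℓ) t => p.slowRate t k) s' := by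
  obtain ⟨a, ha⟩ := exists_uniformlyC1_slowForce (Vh := Vh) (M := M) (ℓ := ℓ) hLd hLq hJ 0
  obtain ⟨b, hb⟩ := exists_uniformlyC1_slowForce (Vh := Vh) (M := M) (ℓ := ℓ) hLd hLq hJ 1
  have hs := uniformlyC1_sin_two (m := m) (Vh := Vh) (M := M) (ℓ := ℓ)
  have hc := uniformlyC1_cos_two (m := m) (Vh := Vh) (M := M) (ℓ := ℓ)
  fin_cases k
  · exact ⟨_, ((((UniformlyC1.const _).sub (hc.const_mul _)).mul ha).sub
      ((hs.const_mul _).mul hb)).const_mul _⟩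
  · exact ⟨_, ((((UniformlyC1.const _).add (hc.const_mul _)).mul hb).sub
      ((hs.const_mul _).mul ha)).const_mul _⟩

/-! ### From the measured current to the saliency vector -/

/-- The filtered and demodulated current recovers the saliency vector up to `O(ωh ^ (-1/2))`. -/
theorem exists_filtered_sub_saliency_le (hLd : 0 < m.Ld) (hLq : 0 < m.Lq) (hJ : 0 < m.J)
    (hVh : 0 < Vh) {ωstar : ℝ} (hωstar : 0 < ωstar) (k : Fin 2) :
    ∃ K > 0, ∀ (p : InjectionLoop m Vh M ℓ), max 1 ωstar⁻¹ ≤ p.ωh → ∀ yh yl : ℝ → Plane,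
      IsHPF p.ωh p.i yh →
      IsLPF (max √(p.ωh * ωstar) 1) (fun t => Real.sin (p.ωh * t + 0) • yh t) yl →
      ∀ᶠ t in atTop, |((2 * (p.ωh / Vh) * m.Ld * m.Lq) • yl t) k - p.saliency t k|
        ≤ K * √(2 * Real.pi / p.ωh) := by
  obtain ⟨s', hs⟩ := exists_uniformlyC1_slowRate (Vh := Vh) (M := M) (ℓ := ℓ) hLd hLq hJ k
  obtain ⟨b', b'', hb, hb'⟩ :=
    exists_uniformlyC1_saliency (m := m) (Vh := Vh) (M := M) (ℓ := ℓ) hJ k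
  obtain ⟨K₁, hK₁⟩ := hs.bounded_deriv
  obtain ⟨K₂, hK₂⟩ := hb.bounded
  obtain ⟨K₃, hK₃⟩ := hb.bounded_deriv
  obtain ⟨K₄, hK₄⟩ := hb'.bounded_deriv
  set V : ℝ := Vh / (m.Ld * m.Lq) with hV
  have hV0 : 0 < V := by positivity
  set K : ℝ := max 1 (max (max K₁ K₂) (max K₃ K₄)) with hK
  have hKpos : 0 < K := lt_of_lt_of_le one_pos (le_max_left _ _)
  have h1 : K₁ ≤ K := by simp [hK]
  have h2 : K₂ ≤ K := by simp [hK]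
  have h3 : K₃ ≤ K := by simp [hK]
  have h4 : K₄ ≤ K := by simp [hK]
  -- A single constant for both the high-pass error and the bounds on `b` and `b'`.
  set N : ℝ := (8 + 12 * V) * K with hN
  have hKN : K ≤ N := by nlinarith
  have hNpos : 0 < N := lt_of_lt_of_le hKpos hKN
  refine ⟨(4 / V + 5) * N * (1 / √ωstar + √ωstar), by positivity, ?_⟩
  rintro p hp yh yl ⟨u', u'', y', y'', hyh⟩ ⟨w', hyl⟩
  have hω1 : 1 ≤ p.ωh := (le_max_left _ _).trans hp
  have hω0 : 0 < p.ωh := by linarith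
  -- The lower bound on `ωh` gives `1 ≤ ωh ωstar`, so the cut-off at 1 is inactive.
  have hl : max √(p.ωh * ωstar) 1 = √p.ωh * √ωstar := by
    rw [max_eq_left, Real.sqrt_mul hω0.le]
    rw [Real.one_le_sqrt, ← inv_mul_cancel₀ hωstar.ne']
    exact mul_le_mul_of_nonneg_right ((le_max_right _ _).trans hp) hωstar.le
  have hH := highPass_ripple hω1 hV0 hKpos
    (fun t ht => (hyh t ht).1.plane_apply k) (fun t ht => (hyh t ht).2.1.plane_apply k)
    (fun t ht => (hyh t ht).2.2.1.plane_apply k) (fun t ht => (hyh t ht).2.2.2.1.plane_apply k)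
    (fun t ht => by simpa using congrArg (fun x : Plane => x k) (hyh t ht).2.2.2.2)
    (fun t ht => by
      have h := p.hasDerivAt_i ht k
      rwa [p.deriv_i_eq hLd hLq ht k] at h)
    (hs.hasDerivAt p) (hb.hasDerivAt p) (hb'.hasDerivAt p)
    (fun t ht => (hK₁ p t ht).trans h1) (fun t ht => (hK₃ p t ht).trans h3)
    (fun t ht => (hK₄ p t ht).trans h4)
  have hL := lowPass_demodulation (w := fun t => yl t k) hω1 (le_max_right √(p.ωh * ωstar) 1) hV0
    hNpos (fun t ht => (hyl t ht).1.plane_apply k)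
    (fun t ht => by simpa using congrArg (fun x : Plane => x k) (hyl t ht).2) hH
    (hb.hasDerivAt p) (fun t ht => (hK₂ p t ht).trans (h2.trans hKN))
    (fun t ht => (hK₃ p t ht).trans (h3.trans hKN))
  filter_upwards [hL] with t ht
  have e1 : ((2 * (p.ωh / Vh) * m.Ld * m.Lq) • yl t) k = 2 * (p.ωh / V) * yl t k := by
    simp only [PiLp.smul_apply, smul_eq_mul, hV]
    field_simp
  rw [e1]
  refine ht.trans ?_
  rw [hl]
  have hsq : 0 < √p.ωh := Real.sqrt_pos.2 hω0
  have hsqs : 0 < √ωstar := Real.sqrt_pos.2 hωstar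
  have e2 : 1 / (√p.ωh * √ωstar) + √p.ωh * √ωstar / p.ωh
      = (1 / √ωstar + √ωstar) * (1 / √p.ωh) := by
    have : √p.ωh * √ωstar / p.ωh = √ωstar * (1 / √p.ωh) := by
      nth_rewrite 2 [← Real.mul_self_sqrt hω0.le]
      field_simp
    rw [this]
    field_simp
  have e3 : 1 / √p.ωh ≤ √(2 * Real.pi / p.ωh) := by
    rw [Real.sqrt_div (by positivity)]
    gcongr
    rw [Real.one_le_sqrt]
    linarith [Real.pi_gt_three]
  rw [e2, ← mul_assoc]
  gcongr

end InjectionLoop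
-- From the saliency vector to the position
namespace IPMSM

/-- The sign convention makes the ideal point `|L₁| (cos 2θ, sin 2θ)` for either sign of `L₁`;
halving the angle turns the ambiguity `2πn` into `πn`. -/
theorem exists_abs_positionEstimate_sub_le (m : IPMSM) (hsal : m.Ld ≠ m.Lq) {θ δ : ℝ} {Y : Plane}
    (h0 : |Y 0 - (m.L0 - m.L1 * Real.cos (2 * θ))| ≤ δ)
    (h1 : |Y 1 - -m.L1 * Real.sin (2 * θ)| ≤ δ) (hδ : 4 * δ ≤ |m.L1|) :
    ∃ n : ℤ, |m.positionEstimate Y - θ - n * Real.pi| ≤ 3 * δ / (2 * |m.L1|) := by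
  have key : ∀ x y : ℝ, |x - |m.L1| * Real.cos (2 * θ)| ≤ δ → |y - |m.L1| * Real.sin (2 * θ)| ≤ δ →
      ∃ n : ℤ, |1 / 2 * atan2 y x - θ - n * Real.pi| ≤ 3 * δ / (2 * |m.L1|) := by
    intro x y hx hy
    have hL : 0 < |m.L1| := by
      rw [abs_pos, IPMSM.L1]
      exact div_ne_zero (sub_ne_zero.2 hsal) two_ne_zero
    obtain ⟨n, hn⟩ := exists_abs_atan2_sub_le hL hx hy hδ
    refine ⟨n, ?_⟩
    have e1 : 1 / 2 * atan2 y x - θ - n * Real.pi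
        = 1 / 2 * (atan2 y x - 2 * θ - 2 * Real.pi * n) := by ring
    have e2 : 3 * δ / (2 * |m.L1|) = 1 / 2 * (3 * δ / |m.L1|) := by
      field_simp
    rw [e1, e2, abs_mul, abs_of_pos (by norm_num : (0 : ℝ) < 1 / 2)]
    gcongr
  rw [positionEstimate]
  split_ifs with h
  · have hL : |m.L1| = -m.L1 := abs_of_neg (by rw [IPMSM.L1]; linarith)
    refine key _ _ ?_ ?_
    · rw [hL]
      convert h0 using 2
      ring
    · rwa [hL]
  · have hL : |m.L1| = m.L1 := abs_of_nonneg (by rw [IPMSM.L1]; linarith)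
    refine key _ _ ?_ ?_
    · rw [hL, ← abs_neg]
      convert h0 using 2
      ring
    · rw [hL, ← abs_neg]
      convert h1 using 2
      ring

theorem abs_positionEstimate_le (m : IPMSM) (Y : Plane) : |m.positionEstimate Y| ≤ Real.pi := by
  have h : ∀ x y : ℝ, |1 / 2 * atan2 y x| ≤ Real.pi := fun x y => by
    rw [abs_mul, abs_of_pos (by norm_num : (0 : ℝ) < 1 / 2), atan2]
    linarith [Complex.abs_arg_le_pi ⟨x, y⟩, abs_nonneg (Complex.arg ⟨x, y⟩)]
  rw [positionEstimate]
  split_ifs <;> exact h _ _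

end IPMSM

theorem proposition1 (m : IPMSM) (hLd : 0 < m.Ld) (hLq : 0 < m.Lq) (hsal : m.Ld ≠ m.Lq)
    (hJ : 0 < m.J) (Vh : ℝ) (hVh : 0 < Vh) (ωstar : ℝ) (hωstar : 0 < ωstar) (M ℓω : ℝ) :
    ∃ ωhstar : ℝ, 0 < ωhstar ∧ ∃ C : ℝ, ∀ ωh : ℝ, ωhstar ≤ ωh →
      ∀ (SigmaC : (ℝ → Plane) → ℝ → Plane) (TL : ℝ → ℝ)
        (i : ℝ → Plane) (θ ω : ℝ → ℝ) (ibar : ℝ → Plane) (θbar ωbar : ℝ → ℝ) (θhat : ℝ → ℝ),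
        -- the closed loop with signal injection, and the one without
        m.IsTrajectory TL (fun t => SigmaC i t + injection Vh ωh t) i θ ω →
        m.IsTrajectory TL (SigmaC ibar) ibar θbar ωbar →
        -- bounded states
        (∀ t > 0, ‖i t‖ ≤ M ∧ |ω t| ≤ M) →
        (∀ t > 0, ‖ibar t‖ ≤ M ∧ |ωbar t| ≤ M) →
        -- the bound on speed, acceleration and rate of change of the control
        (∀ t > 0, DifferentiableAt ℝ (SigmaC i) t) →
        (∀ t > 0, √(ωbar t ^ 2 + deriv ωbar t ^ 2 + ‖deriv (SigmaC i) t‖ ^ 2) ≤ ℓω) →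
        -- the conventional signal processing, with zero phase
        m.IsFilteredEstimate Vh ωh ωh (max √(ωh * ωstar) 1) 0 i θhat →
        (∃ T : ℝ, ∀ t ≥ T, ∃ n : ℤ, |θhat t - θ t - n * Real.pi| ≤ C * √(2 * Real.pi / ωh)) ∧
        ((∃ B : ℝ, ∀ t > 0, |θ t| ≤ B) →
          ∃ n : ℤ, |Filter.limsup (fun t => |θhat t - θ t|) Filter.atTop - n * Real.pi|
            ≤ C * √(2 * Real.pi / ωh)) := by
  obtain ⟨K₀, hK₀, h₀⟩ := InjectionLoop.exists_filtered_sub_saliency_le (m := m) (Vh := Vh) (M := M)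
    (ℓ := ℓω) hLd hLq hJ hVh hωstar 0
  obtain ⟨K₁, hK₁, h₁⟩ := InjectionLoop.exists_filtered_sub_saliency_le (m := m) (Vh := Vh) (M := M)
    (ℓ := ℓω) hLd hLq hJ hVh hωstar 1
  set K : ℝ := max K₀ K₁ with hK
  have hKpos : 0 < K := lt_of_lt_of_le hK₀ (le_max_left _ _)
  have hL : 0 < |m.L1| := by
    rw [abs_pos, IPMSM.L1]
    exact div_ne_zero (sub_ne_zero.2 hsal) two_ne_zero
  -- The second entry of the maximum keeps the error in `Y` below `|L₁| / 4`, as the arctangent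
  -- estimate requires.
  refine ⟨max (max 1 ωstar⁻¹) (2 * Real.pi * (4 * K / |m.L1|) ^ 2),
    lt_of_lt_of_le one_pos ((le_max_left _ _).trans (le_max_left _ _)), 3 * K / (2 * |m.L1|), ?_⟩
  intro ωh hωh SigmaC TL i θ ω ibar θbar ωbar θhat htraj hbar hb hbb hdiff hslow hest
  obtain ⟨yh, yl, hH, hLP, hθ⟩ := hest
  have hω0 : 0 < ωh := lt_of_lt_of_le one_pos
    (((le_max_left _ _).trans (le_max_left _ _)).trans hωh)
  let p : InjectionLoop m Vh M ℓω := ⟨ωh, SigmaC i, SigmaC ibar, TL, i, θ, ω, ibar, θbar, ωbar,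
    htraj, hbar, hb, hbb, hdiff, hslow⟩
  have hp : max 1 ωstar⁻¹ ≤ p.ωh := (le_max_left _ _).trans hωh
  have hsmall : 4 * (K * √(2 * Real.pi / ωh)) ≤ |m.L1| := by
    have h1 : √(2 * Real.pi / ωh) ≤ |m.L1| / (4 * K) := by
      refine Real.sqrt_le_iff.2 ⟨by positivity, ?_⟩
      have h2 := (le_max_right _ _).trans hωh
      rw [div_le_iff₀ hω0]
      calc 2 * Real.pi = (|m.L1| / (4 * K)) ^ 2 * (2 * Real.pi * (4 * K / |m.L1|) ^ 2) := by
            field_simp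
        _ ≤ _ := by gcongr
    calc 4 * (K * √(2 * Real.pi / ωh)) ≤ 4 * (K * (|m.L1| / (4 * K))) := by gcongr
      _ = |m.L1| := by field_simp
  have hmain : ∀ᶠ t in atTop, ∃ n : ℤ, |θhat t - θ t - n * Real.pi|
      ≤ 3 * K / (2 * |m.L1|) * √(2 * Real.pi / ωh) := by
    filter_upwards [h₀ p hp yh yl hH hLP, h₁ p hp yh yl hH hLP, eventually_gt_atTop 0]
      with t ht₀ ht₁ ht
    have hs := Real.sqrt_nonneg (2 * Real.pi / ωh)
    obtain ⟨n, hn⟩ := m.exists_abs_positionEstimate_sub_le hsal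
      (ht₀.trans (mul_le_mul_of_nonneg_right (le_max_left _ _) hs))
      (ht₁.trans (mul_le_mul_of_nonneg_right (le_max_right _ _) hs)) hsmall
    refine ⟨n, ?_⟩
    rw [hθ t ht]
    refine hn.trans (le_of_eq ?_)
    ring
  refine ⟨eventually_atTop.1 hmain, ?_⟩
  rintro ⟨B, hB⟩
  refine exists_abs_limsup_sub_int_mul_le (B := Real.pi + B) ?_ ?_
  · filter_upwards [eventually_gt_atTop 0] with t ht
    rw [abs_abs]
    refine (abs_sub _ _).trans (add_le_add ?_ (hB t ht))
    rw [hθ t ht]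
    exact m.abs_positionEstimate_le _
  · filter_upwards [hmain] with t ⟨n, hn⟩
    -- The set `πℤ` is symmetric, so taking the absolute value of the error at most changes `n` to
    -- `-n`.
    rcases abs_choice (θhat t - θ t) with h | h
    · exact ⟨n, by rwa [h]⟩
    · refine ⟨-n, ?_⟩
      rw [h, ← abs_neg]
      convert hn using 2
      push_cast
      ring
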